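/- Let $1\le N\le 3$ and $\mu_1,\mu_2,\beta>0$. Let $a,b:\mathbb R^N\to\mathbb R$ be continuous with $$0=\inf_{\mathbb R^N}a<\liminf_{|x|\to\infty}a(x),\qquad 0=\inf_{\mathbb R^N}b<\liminf_{|x|\to\infty}b(x)$$ (the lower limits may be $+\infty$), and let $\Omega=\{x: a(x)=b(x)=0\}$. A function $W:\mathbb R^N\to\mathbb R$ is called positive $\gamma$-homogeneous if $W(y)>0$ for $y\ne0$ and $W(ty)=t^\gamma W(y)$ for all $t\ge0$, $y\in\mathbb R^N$. Assume that for some $\gamma>0$ every $x\in\Omega$ satisfies one of (i) $\displaystyle\lim_{z\to x}\frac{a(z)}{|z-x|^\gamma}=+\infty$; (ii) there is a continuous positive $\gamma$-homogeneous function $W$ with $\displaystyle\lim_{z\to x}\frac{a(z)-W(z-x)}{|z-x|^\gamma}=0$. Let $\{x_i: i\in\mathcal I\}\subset\Omega$ be the set of all points at which (ii) holds, with corresponding functions $W_i$; assume that this set is nonempty and that for every $i\in\mathcal I$ also $\displaystyle\lim_{z\to x_i}\frac{b(z)-W_i(z-x_i)}{|z-x_i|^\gamma}=0$. For $d>0$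 and continuous $A,B\ge0$ on $\mathbb R^N$ put $$I_{d,A,B}(u,v)=\frac12\int_{\mathbb R^N}d|\nabla u|^2+Au^2+d|\nabla v|^2+Bv^2-\frac14\int_{\mathbb R^N}\mu_1u^4+2\beta u^2v^2+\mu_2v^4$$ for $u,v\in H^1(\mathbb R^N)$ with $\int Au^2<\infty$ and $\int Bv^2<\infty$, and let $m_{d,A,B}$ be the infimum of $I_{d,A,B}$ over all such $(u,v)\ne(0,0)$ with $\langle I_{d,A,B}'(u,v),(u,v)\rangle=0$. Let $c_\varepsilon=m_{\varepsilon^2,a,b}$ be the ground state energy of the system $$-\varepsilon^2\Delta u+a(x)u=\mu_1u^3+\beta v^2u,\qquad -\varepsilon^2\Delta v+b(x)v=\mu_2v^3+\beta u^2v\quad\text{in }\mathbb R^N,$$ and let $\mathcal E_W=m_{1,W,W}$ be the ground state energy of $$-\Delta u+W(x)u=\mu_1u^3+\beta v^2u,\qquad -\Delta v+W(x)v=\mu_2v^3+\beta u^2v\quad\text{in }\mathbb R^N.$$ Then, with $k=2/(2+\gamma)$, there is a point $x_*\in\{x_i:i\in\mathcal I\}$, with corresponding function $W_{x_*}$, such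 that $$\limsup_{\varepsilon\to0^+}\frac{c_\varepsilon}{\varepsilon^{k(N+2\gamma)}}\le\mathcal E_{W_{x_*}}=\inf_{i\in\mathcal I}\mathcal E_{W_i}.$$ -/

import Mathlib

open Set Filter Topology MeasureTheory
open scoped ContDiff

noncomputable section

/-- `ℝ^N` with the Euclidean norm. -/
abbrev RSpace (N : ℕ) : Type := EuclideanSpace ℝ (Fin N)

/-- `g` is a distributional gradient of `u`: for every test function `φ ∈ C_c^∞(ℝ^N)` and every
direction `e`, `∫ u ∂_e φ = - ∫ (g · e) φ`. -/
def HasWeakGradient {N : ℕ} (u : RSpace N → ℝ) (g : RSpace N → RSpace N) : Prop :=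
  ∀ φ : RSpace N → ℝ, ContDiff ℝ ∞ φ → HasCompactSupport φ → ∀ e : RSpace N,
    ∫ x, u x * fderiv ℝ φ x e = - ∫ x, inner ℝ (g x) e * φ x

/-- `u ∈ H¹(ℝ^N)`: `u` is square integrable and has a square integrable distributional gradient. -/
def MemHOne {N : ℕ} (u : RSpace N → ℝ) : Prop :=
  MemLp u 2 volume ∧ ∃ g : RSpace N → RSpace N, MemLp g 2 volume ∧ HasWeakGradient u g

open Classical in
/-- The distributional gradient `∇u` of `u ∈ H¹(ℝ^N)` (unique up to a null set); the zero field
outside `H¹(ℝ^N)`. -/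
def weakGradient {N : ℕ} (u : RSpace N → ℝ) : RSpace N → RSpace N :=
  if h : ∃ g : RSpace N → RSpace N, MemLp g 2 volume ∧ HasWeakGradient u g
  then Classical.choose h else 0

/-- The weighted space `{u ∈ H¹(ℝ^N) : ∫ A u² < ∞}`, for a potential `A ≥ 0`. -/
def MemWeighted {N : ℕ} (A : RSpace N → ℝ) (u : RSpace N → ℝ) : Prop :=
  MemHOne u ∧ Integrable (fun x => A x * u x ^ 2) volume

/-- The energy
`½ ∫ d|∇u|² + A u² + d|∇v|² + B v² - ¼ ∫ μ₁ u⁴ + 2 β u² v² + μ₂ v⁴`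
of the system `-d Δu + A u = μ₁ u³ + β v² u`, `-d Δv + B v = μ₂ v³ + β u² v` on `ℝ^N`. -/
def energy {N : ℕ} (μ₁ μ₂ β d : ℝ) (A B : RSpace N → ℝ) (u v : RSpace N → ℝ) : ℝ :=
  (1 / 2) * (∫ x, (d * ‖weakGradient u x‖ ^ 2 + A x * u x ^ 2
      + d * ‖weakGradient v x‖ ^ 2 + B x * v x ^ 2))
    - (1 / 4) * ∫ x, (μ₁ * u x ^ 4 + 2 * β * u x ^ 2 * v x ^ 2 + μ₂ * v x ^ 4)

/-- The Nehari set of the energy `I`: the pairs `(u, v) ≠ (0, 0)` in the product of the weighted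
spaces with `⟨I'(u, v), (u, v)⟩ = 0`, the pairing being the derivative at `t = 0` of
`t ↦ I((u, v) + t (u, v))`. -/
def nehari {N : ℕ} (μ₁ μ₂ β d : ℝ) (A B : RSpace N → ℝ) :
    Set ((RSpace N → ℝ) × (RSpace N → ℝ)) :=
  {p | MemWeighted A p.1 ∧ MemWeighted B p.2 ∧
    ¬ (p.1 =ᵐ[volume] 0 ∧ p.2 =ᵐ[volume] 0) ∧
    HasDerivAt (fun t : ℝ => energy μ₁ μ₂ β d A B (p.1 + t • p.1) (p.2 + t • p.2)) 0 0}

/-- The ground state energy: the infimum of the energy over its Nehari set. -/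
def groundEnergy {N : ℕ} (μ₁ μ₂ β d : ℝ) (A B : RSpace N → ℝ) : ℝ :=
  sInf ((fun p => energy μ₁ μ₂ β d A B p.1 p.2) '' nehari μ₁ μ₂ β d A B)

/-- `c_ε`: the ground state energy of `-ε² Δu + a u = μ₁ u³ + β v² u`,
`-ε² Δv + b v = μ₂ v³ + β u² v`. -/
def semiclassicalLevel {N : ℕ} (μ₁ μ₂ β : ℝ) (a b : RSpace N → ℝ) (ε : ℝ) : ℝ :=
  groundEnergy μ₁ μ₂ β (ε ^ 2) a b

/-- `𝓔_W`: the ground state energy of the limit system `-Δu + W u = μ₁ u³ + β v² u`,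
`-Δv + W v = μ₂ v³ + β u² v`. -/
def limitLevel {N : ℕ} (μ₁ μ₂ β : ℝ) (W : RSpace N → ℝ) : ℝ :=
  groundEnergy μ₁ μ₂ β 1 W W

/-- Positive `γ`-homogeneous functions. -/
def IsPosHomogeneous {N : ℕ} (γ : ℝ) (W : RSpace N → ℝ) : Prop :=
  (∀ y, y ≠ 0 → 0 < W y) ∧ ∀ t : ℝ, 0 ≤ t → ∀ y, W (t • y) = t ^ γ * W y

/-- `(a(z) - W(z - x)) / |z - x|^γ → 0` as `z → x`. -/
def HasLocalModel {N : ℕ} (γ : ℝ) (a : RSpace N → ℝ) (x : RSpace N) (W : RSpace N → ℝ) : Prop :=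
  Tendsto (fun z => (a z - W (z - x)) / ‖z - x‖ ^ γ) (𝓝[≠] x) (𝓝 0)

/-- `a(z) / |z - x|^γ → +∞` as `z → x`. -/
def IsSteepAt {N : ℕ} (γ : ℝ) (a : RSpace N → ℝ) (x : RSpace N) : Prop :=
  Tendsto (fun z => a z / ‖z - x‖ ^ γ) (𝓝[≠] x) atTop

/-- `Ω`, the set of common zeros of the two potentials. -/
def commonZeros {N : ℕ} (a b : RSpace N → ℝ) : Set (RSpace N) :=
  {x | a x = 0 ∧ b x = 0}

/-- The points `{x_i : i ∈ 𝓘}` of `Ω` at which `a` has a continuous positive `γ`-homogeneous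
model. -/
def modelPoints {N : ℕ} (γ : ℝ) (a b : RSpace N → ℝ) : Set (RSpace N) :=
  {x | x ∈ commonZeros a b ∧
    ∃ W : RSpace N → ℝ, Continuous W ∧ IsPosHomogeneous γ W ∧ HasLocalModel γ a x W}

/-- The standing assumption on a potential: it is continuous and
`0 = inf a < liminf_{|x| → ∞} a(x)`, where the lower limit may be `+∞`. -/
def IsCriticalPotential {N : ℕ} (a : RSpace N → ℝ) : Prop :=
  Continuous a ∧ IsGLB (range a) 0 ∧
    (0 : EReal) < liminf (fun x => (a x : EReal)) (Bornology.cobounded (RSpace N))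

end

/-! Write `Q` for the quadratic and `P` for the quartic integral. On the Nehari set `Q = P` and the
energy is `Q / 4`. A pair with `Q, P > 0` has a multiple on the Nehari set, of energy `Q² / (4P)`,
so every such pair bounds the ground state energy from above.

Test the semiclassical problem with a compactly supported pair concentrated at a model point `x₀` at
scale `δ = ε ^ k`. Since `ε² = δ ^ (γ + 2)`, gradient and potential terms both scale like `δ ^ (N +
γ)` and the quartic term like `δ ^ N`, so `Q² / P` carries exactly `δ ^ (N + 2γ) = ε ^ (k(N + 2γ))`
(`groundEnergy_le_rescale`). The blown-up potentials converge to `W` locally uniformly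
(`HasLocalModel.blowUp_sub_le`), hence the limsup is at most `Q² / (4P)` for the limit system.
Truncation extends this to all Nehari pairs, and the infimum gives the bound by `limitLevel`.

The infimum over model points is attained because there are finitely many (`finite_commonZeros`):
the common zeros form a compact set, and either local alternative makes each of them isolated. -/

noncomputable section

/-! ### Weak gradients: uniqueness, Leibniz rule, affine rescaling. -/

section WeakGradient

variable {N : ℕ} {u : RSpace N → ℝ} {g g' : RSpace N → RSpace N}

lemma integrable_inner_left (hg : LocallyIntegrable g volume) {φ : RSpace N → ℝ}
    (hφ : Continuous φ) (hs : HasCompactSupport φ) (e : RSpace N) :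
    Integrable (fun x => inner ℝ (g x) e * φ x) volume := by
  have h := (hg.integrable_smul_left_of_hasCompactSupport hφ hs).inner_const (𝕜 := ℝ) e
  refine h.congr (.of_forall fun x => ?_)
  simp only [real_inner_smul_left]
  ring

/-- Since `weakGradient` is an arbitrary choice, this uniqueness is what allows it to be computed.
Pairing the difference with every direction `e` reduces it to the fundamental lemma of the calculus
of variations. -/
lemma HasWeakGradient.ae_eq (h : HasWeakGradient u g) (h' : HasWeakGradient u g')
    (hg : LocallyIntegrable g volume) (hg' : LocallyIntegrable g' volume) : g =ᵐ[volume] g' := by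
  have key := ae_eq_zero_of_integral_contDiff_smul_eq_zero (hg.sub hg') (fun φ hφ hs => by
    have hi := (hg.sub hg').integrable_smul_left_of_hasCompactSupport hφ.continuous hs
    refine ext_inner_right ℝ fun e => ?_
    rw [real_inner_comm, ← integral_inner hi e, inner_zero_left]
    have h1 := integrable_inner_left hg hφ.continuous hs e
    have h2 := integrable_inner_left hg' hφ.continuous hs e
    have e1 : ∀ x, inner ℝ e (φ x • (g - g') x)
        = inner ℝ (g x) e * φ x - inner ℝ (g' x) e * φ x := fun x => by
      rw [real_inner_comm, real_inner_smul_left, Pi.sub_apply, inner_sub_left]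
      ring
    simp_rw [e1]
    rw [integral_sub h1 h2]
    have := h φ hφ hs e
    have := h' φ hφ hs e
    linarith)
  filter_upwards [key] with x hx
  exact sub_eq_zero.1 hx

lemma MemHOne.weakGradient_spec (h : MemHOne u) :
    MemLp (weakGradient u) 2 volume ∧ HasWeakGradient u (weakGradient u) := by
  rw [weakGradient, dif_pos h.2]
  exact Classical.choose_spec h.2

lemma HasWeakGradient.weakGradient_ae_eq (h : HasWeakGradient u g) (hg : MemLp g 2 volume) :
    weakGradient u =ᵐ[volume] g := by
  have hex : ∃ g : RSpace N → RSpace N, MemLp g 2 volume ∧ HasWeakGradient u g := ⟨g, hg, h⟩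
  have hs := Classical.choose_spec hex
  rw [weakGradient, dif_pos hex]
  exact hs.2.ae_eq h (hs.1.locallyIntegrable (by norm_num)) (hg.locallyIntegrable (by norm_num))

lemma HasWeakGradient.const_smul (h : HasWeakGradient u g) (t : ℝ) :
    HasWeakGradient (t • u) (t • g) := by
  intro φ hφ hs e
  have := h φ hφ hs e
  simp only [Pi.smul_apply, smul_eq_mul, real_inner_smul_left, mul_assoc, integral_const_mul]
  rw [this]
  ring

lemma MemHOne.const_smul (h : MemHOne u) (t : ℝ) : MemHOne (t • u) :=
  ⟨h.1.const_smul t, t • weakGradient u, h.weakGradient_spec.1.const_smul t,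
    h.weakGradient_spec.2.const_smul t⟩

lemma MemHOne.weakGradient_smul (h : MemHOne u) (t : ℝ) :
    weakGradient (t • u) =ᵐ[volume] t • weakGradient u :=
  (h.weakGradient_spec.2.const_smul t).weakGradient_ae_eq (h.weakGradient_spec.1.const_smul t)

lemma continuous_gradient {χ : RSpace N → ℝ} (hχ : ContDiff ℝ ∞ χ) :
    Continuous (gradient χ) :=
  (LinearIsometryEquiv.continuous _).comp (hχ.continuous_fderiv (by simp))

/-- Apply the definition for `u` to the test function `χ φ`; only `φ` has to have compact support.
-/
lemma HasWeakGradient.smooth_mul (h : HasWeakGradient u g) (hu : LocallyIntegrable u volume)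
    (hg : LocallyIntegrable g volume) {χ : RSpace N → ℝ} (hχ : ContDiff ℝ ∞ χ) :
    HasWeakGradient (fun x => χ x * u x) (fun x => χ x • g x + u x • gradient χ x) := by
  intro φ hφ hs e
  have hd : Continuous fun x => fderiv ℝ φ x e :=
    (hφ.continuous_fderiv (by simp)).clm_apply continuous_const
  have hdχ : Continuous fun x => fderiv ℝ χ x e :=
    (hχ.continuous_fderiv (by simp)).clm_apply continuous_const
  have hsd : HasCompactSupport fun x => fderiv ℝ φ x e := hs.fderiv_apply (𝕜 := ℝ) e
  have hprod : ContDiff ℝ ∞ fun x => χ x * φ x := hχ.mul hφ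
  have hps : HasCompactSupport fun x => χ x * φ x := hs.mul_left
  have hw := h _ hprod hps e
  have hder : ∀ x, fderiv ℝ (fun x => χ x * φ x) x e
      = χ x * fderiv ℝ φ x e + φ x * fderiv ℝ χ x e := fun x => by
    rw [fderiv_fun_mul (hχ.differentiable (by simp) x) (hφ.differentiable (by simp) x)]
    simp
  have i1 : Integrable (fun x => u x * (χ x * fderiv ℝ φ x e)) volume := by
    simpa using hu.integrable_smul_right_of_hasCompactSupport (hχ.continuous.mul hd) hsd.mul_left
  have i2 : Integrable (fun x => u x * (φ x * fderiv ℝ χ x e)) volume := by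
    simpa using hu.integrable_smul_right_of_hasCompactSupport (hφ.continuous.mul hdχ) hs.mul_right
  have i3 := integrable_inner_left hg hprod.continuous hps e
  simp_rw [hder, mul_add] at hw
  rw [integral_add i1 i2] at hw
  have e1 : ∀ x, inner ℝ (χ x • g x + u x • gradient χ x) e * φ x
      = inner ℝ (g x) e * (χ x * φ x) + u x * (φ x * fderiv ℝ χ x e) := fun x => by
    rw [inner_add_left, real_inner_smul_left, real_inner_smul_left, inner_gradient_left]
    ring
  simp_rw [e1]
  rw [integral_add i3 i2]
  have e2 : ∀ x, χ x * u x * fderiv ℝ φ x e = u x * (χ x * fderiv ℝ φ x e) := fun x => by ring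
  simp_rw [e2]
  linarith

/-- Combined with the product rule, this yields the weak gradient of any smooth function. -/
lemma hasWeakGradient_const_one : HasWeakGradient (fun _ : RSpace N => (1 : ℝ)) 0 := by
  intro φ hφ hs e
  have hd : Continuous fun x => fderiv ℝ φ x e :=
    (hφ.continuous_fderiv (by simp)).clm_apply continuous_const
  have hsd : HasCompactSupport fun x => fderiv ℝ φ x e := hs.fderiv_apply (𝕜 := ℝ) e
  have := integral_mul_fderiv_eq_neg_fderiv_mul_of_integrable (μ := (volume : Measure (RSpace N)))
    (f := fun _ => (1 : ℝ)) (g := φ) (v := e) (by simp)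
    (by simpa using hd.integrable_of_hasCompactSupport hsd)
    (by simpa using hφ.continuous.integrable_of_hasCompactSupport hs) (by simp)
    (fun x _ => hφ.differentiable (by simp) x)
  rw [this]
  simp

lemma memHOne_of_contDiff {χ : RSpace N → ℝ} (hχ : ContDiff ℝ ∞ χ) (hs : HasCompactSupport χ) :
    MemHOne χ := by
  refine ⟨hχ.continuous.memLp_of_hasCompactSupport hs, gradient χ, ?_, ?_⟩
  · refine (continuous_gradient hχ).memLp_of_hasCompactSupport ?_
    exact (hs.fderiv (𝕜 := ℝ)).comp_left (map_zero _)
  · have := hasWeakGradient_const_one.smooth_mul (N := N) (locallyIntegrable_const 1)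
      (locallyIntegrable_const 0) hχ
    simpa using this

/-- The affine rescaling `z ↦ (z - x₀) / δ`. -/
def rescale (x₀ : RSpace N) (δ : ℝ) (z : RSpace N) : RSpace N := δ⁻¹ • (z - x₀)

lemma integral_rescale {F : Type*} [NormedAddCommGroup F] [NormedSpace ℝ F] (x₀ : RSpace N)
    {δ : ℝ} (hδ : 0 < δ) (f : RSpace N → F) :
    ∫ z, f (rescale x₀ δ z) = δ ^ N • ∫ y, f y := by
  have h1 := integral_sub_right_eq_self (μ := (volume : Measure (RSpace N)))
    (fun z => f (δ⁻¹ • z)) x₀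
  have h2 := Measure.integral_comp_inv_smul (volume : Measure (RSpace N)) f δ
  simp only [rescale]
  rw [h1, h2, finrank_euclideanSpace_fin, abs_of_pos (by positivity)]

lemma quasiMeasurePreserving_rescale (x₀ : RSpace N) {δ : ℝ} (hδ : 0 < δ) :
    Measure.QuasiMeasurePreserving (rescale x₀ δ) volume volume := by
  have h1 : Measure.QuasiMeasurePreserving (fun y : RSpace N => δ⁻¹ • y) volume volume :=
    ⟨measurable_const_smul _, by
      rw [Measure.map_addHaar_smul _ (inv_ne_zero hδ.ne')]
      exact Measure.smul_absolutelyContinuous⟩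
  exact h1.comp (measurePreserving_sub_right volume x₀).quasiMeasurePreserving

lemma integrable_rescale {F : Type*} [NormedAddCommGroup F] (x₀ : RSpace N)
    {δ : ℝ} (hδ : 0 < δ) {f : RSpace N → F} (hf : Integrable f volume) :
    Integrable (fun z => f (rescale x₀ δ z)) volume := by
  have h1 := hf.comp_smul (inv_ne_zero hδ.ne')
  exact h1.comp_sub_right x₀

lemma memLp_rescale {F : Type*} [NormedAddCommGroup F] (x₀ : RSpace N)
    {δ : ℝ} (hδ : 0 < δ) {f : RSpace N → F} (hf : MemLp f 2 volume) :
    MemLp (fun z => f (rescale x₀ δ z)) 2 volume := by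
  have hm := hf.1.comp_quasiMeasurePreserving (quasiMeasurePreserving_rescale x₀ hδ)
  exact (memLp_two_iff_integrable_sq_norm hm).2
    (integrable_rescale x₀ hδ ((memLp_two_iff_integrable_sq_norm hf.1).1 hf))

lemma rescale_add_smul (x₀ : RSpace N) {δ : ℝ} (hδ : 0 < δ) (z : RSpace N) :
    x₀ + δ • rescale x₀ δ z = z := by
  rw [rescale, smul_inv_smul₀ hδ.ne']
  abel

/-- Pull the test function back to `y ↦ φ (x₀ + δ • y)`. The Jacobian `δ ^ N` appears on both sides,
and the chain rule leaves the factor `δ⁻¹`. -/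
lemma HasWeakGradient.rescale (h : HasWeakGradient u g) (x₀ : RSpace N) {δ : ℝ} (hδ : 0 < δ) :
    HasWeakGradient (fun z => u (rescale x₀ δ z)) (fun z => δ⁻¹ • g (rescale x₀ δ z)) := by
  intro φ hφ hs e
  set ψ : RSpace N → ℝ := fun y => φ (x₀ + δ • y) with hψ
  have hψd : ContDiff ℝ ∞ ψ := hφ.comp (contDiff_const.add (contDiff_id.const_smul δ))
  have hψs : HasCompactSupport ψ := hs.comp_homeomorph
    ((Homeomorph.smulOfNeZero δ hδ.ne').trans (Homeomorph.addLeft x₀))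
  have hder : ∀ y, fderiv ℝ ψ y e = δ * fderiv ℝ φ (x₀ + δ • y) e := fun y => by
    have h1 : HasFDerivAt (fun y : RSpace N => x₀ + δ • y)
        (δ • ContinuousLinearMap.id ℝ (RSpace N)) y :=
      ((hasFDerivAt_id y).const_smul δ).const_add x₀
    have h2 := ((hφ.differentiable (by simp) (x₀ + δ • y)).hasFDerivAt.comp y h1).fderiv
    rw [show ψ = φ ∘ fun y => x₀ + δ • y from rfl, h2]
    simp
  have hw := h ψ hψd hψs e
  have e1 : ∀ z, u (_root_.rescale x₀ δ z) * fderiv ℝ φ z e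
      = δ⁻¹ * (fun y => u y * fderiv ℝ ψ y e) (_root_.rescale x₀ δ z) := fun z => by
    simp only [hder, rescale_add_smul x₀ hδ]
    field_simp
  have e2 : ∀ z, inner ℝ (δ⁻¹ • g (_root_.rescale x₀ δ z)) e * φ z
      = δ⁻¹ * (fun y => inner ℝ (g y) e * ψ y) (_root_.rescale x₀ δ z) := fun z => by
    simp only [hψ, rescale_add_smul x₀ hδ, real_inner_smul_left]
    ring
  have h1 := integral_rescale x₀ hδ fun y => u y * fderiv ℝ ψ y e
  have h2 := integral_rescale x₀ hδ fun y => inner ℝ (g y) e * ψ y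
  simp only [smul_eq_mul] at h1 h2
  simp_rw [e1, e2]
  rw [integral_const_mul, integral_const_mul, h1, h2, hw]
  ring

lemma MemHOne.rescale (h : MemHOne u) (x₀ : RSpace N) {δ : ℝ} (hδ : 0 < δ) :
    MemHOne fun z => u (rescale x₀ δ z) :=
  ⟨memLp_rescale x₀ hδ h.1, _, (memLp_rescale x₀ hδ h.weakGradient_spec.1).const_smul δ⁻¹,
    h.weakGradient_spec.2.rescale x₀ hδ⟩

lemma MemHOne.weakGradient_rescale (h : MemHOne u) (x₀ : RSpace N) {δ : ℝ} (hδ : 0 < δ) :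
    weakGradient (fun z => u (_root_.rescale x₀ δ z))
      =ᵐ[volume] fun z => δ⁻¹ • weakGradient u (_root_.rescale x₀ δ z) :=
  (h.weakGradient_spec.2.rescale x₀ hδ).weakGradient_ae_eq
    ((memLp_rescale x₀ hδ h.weakGradient_spec.1).const_smul δ⁻¹)

end WeakGradient

/-! ### The Nehari set and the quotient `Q² / (4P)`. -/

section Nehari

variable {N : ℕ} {μ₁ μ₂ β d : ℝ} {A B : RSpace N → ℝ} {u v : RSpace N → ℝ}

/-- The quadratic integral of the energy. -/
def quadraticPart (d : ℝ) (A B u v : RSpace N → ℝ) : ℝ :=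
  ∫ x, (d * ‖weakGradient u x‖ ^ 2 + A x * u x ^ 2
      + d * ‖weakGradient v x‖ ^ 2 + B x * v x ^ 2)

/-- The quartic integral of the energy. -/
def quarticPart (μ₁ μ₂ β : ℝ) (u v : RSpace N → ℝ) : ℝ :=
  ∫ x, (μ₁ * u x ^ 4 + 2 * β * u x ^ 2 * v x ^ 2 + μ₂ * v x ^ 4)

lemma energy_eq : energy μ₁ μ₂ β d A B u v
    = (1 / 2) * quadraticPart d A B u v - (1 / 4) * quarticPart μ₁ μ₂ β u v := rfl

lemma quadraticPart_smul (hu : MemHOne u) (hv : MemHOne v) (t : ℝ) :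
    quadraticPart d A B (t • u) (t • v) = t ^ 2 * quadraticPart d A B u v := by
  rw [quadraticPart, quadraticPart, ← integral_const_mul]
  refine integral_congr_ae ?_
  filter_upwards [hu.weakGradient_smul t, hv.weakGradient_smul t] with x h1 h2
  simp only [h1, h2, Pi.smul_apply, norm_smul, Real.norm_eq_abs, smul_eq_mul, mul_pow, sq_abs]
  ring

lemma quarticPart_smul (t : ℝ) :
    quarticPart μ₁ μ₂ β (t • u) (t • v) = t ^ 4 * quarticPart μ₁ μ₂ β u v := by
  rw [quarticPart, quarticPart, ← integral_const_mul]
  congr 1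
  ext x
  simp only [Pi.smul_apply, smul_eq_mul]
  ring

/-- By homogeneity the energy along the ray is a polynomial in `1 + t`. Constants leave the Bochner
integral unconditionally, so integrability of the quartic term is not needed. -/
lemma hasDerivAt_energy (hu : MemHOne u) (hv : MemHOne v) :
    HasDerivAt (fun t : ℝ => energy μ₁ μ₂ β d A B (u + t • u) (v + t • v))
      (quadraticPart d A B u v - quarticPart μ₁ μ₂ β u v) 0 := by
  have e : (fun t : ℝ => energy μ₁ μ₂ β d A B (u + t • u) (v + t • v))
      = fun t : ℝ => (1 / 2) * ((1 + t) ^ 2 * quadraticPart d A B u v)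
        - (1 / 4) * ((1 + t) ^ 4 * quarticPart μ₁ μ₂ β u v) := by
    ext t
    have h : ∀ w : RSpace N → ℝ, w + t • w = (1 + t) • w := fun w => by rw [add_smul, one_smul]
    rw [h, h, energy_eq, quadraticPart_smul hu hv, quarticPart_smul]
  rw [e]
  have h1 : HasDerivAt (fun t : ℝ => 1 + t) 1 0 := (hasDerivAt_id 0).const_add 1
  have h2 := (((h1.pow 2).mul_const (quadraticPart d A B u v)).const_mul (1 / 2)).sub
    (((h1.pow 4).mul_const (quarticPart μ₁ μ₂ β u v)).const_mul (1 / 4))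
  refine h2.congr_deriv ?_
  norm_num
  ring

lemma mem_nehari_iff (hu : MemWeighted A u) (hv : MemWeighted B v) :
    (u, v) ∈ nehari μ₁ μ₂ β d A B ↔
      ¬ (u =ᵐ[volume] 0 ∧ v =ᵐ[volume] 0) ∧
        quadraticPart d A B u v = quarticPart μ₁ μ₂ β u v := by
  have h := hasDerivAt_energy (μ₁ := μ₁) (μ₂ := μ₂) (β := β) (d := d) (A := A) (B := B) hu.1 hv.1
  constructor
  · rintro ⟨-, -, h0, h1⟩
    exact ⟨h0, sub_eq_zero.1 (h.unique h1)⟩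
  · rintro ⟨h0, h1⟩
    refine ⟨hu, hv, h0, ?_⟩
    rw [h1, sub_self] at h
    exact h

lemma energy_of_mem_nehari {p : (RSpace N → ℝ) × (RSpace N → ℝ)}
    (hp : p ∈ nehari μ₁ μ₂ β d A B) :
    quarticPart μ₁ μ₂ β p.1 p.2 = quadraticPart d A B p.1 p.2 ∧
      energy μ₁ μ₂ β d A B p.1 p.2 = quadraticPart d A B p.1 p.2 / 4 := by
  have h := ((mem_nehari_iff hp.1 hp.2.1).1 hp).2
  refine ⟨h.symm, ?_⟩
  rw [energy_eq, ← h]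
  ring

lemma quadraticPart_nonneg (hd : 0 ≤ d) (hA : ∀ x, 0 ≤ A x) (hB : ∀ x, 0 ≤ B x) :
    0 ≤ quadraticPart d A B u v :=
  integral_nonneg fun x => by
    have := hA x
    have := hB x
    simp only [Pi.zero_apply]
    positivity

lemma bddBelow_energy_nehari (hd : 0 ≤ d) (hA : ∀ x, 0 ≤ A x) (hB : ∀ x, 0 ≤ B x) :
    BddBelow ((fun p => energy μ₁ μ₂ β d A B p.1 p.2) '' nehari μ₁ μ₂ β d A B) := by
  refine ⟨0, ?_⟩
  rintro _ ⟨p, hp, rfl⟩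
  have := quadraticPart_nonneg (u := p.1) (v := p.2) hd hA hB
  simp only [(energy_of_mem_nehari hp).2]
  positivity

lemma MemWeighted.const_smul (hu : MemWeighted A u) (t : ℝ) : MemWeighted A (t • u) := by
  refine ⟨hu.1.const_smul t, (hu.2.const_mul (t ^ 2)).congr (.of_forall fun x => ?_)⟩
  simp only [Pi.smul_apply, smul_eq_mul]
  ring

lemma quarticPart_eq_zero (hu : u =ᵐ[volume] 0) (hv : v =ᵐ[volume] 0) :
    quarticPart μ₁ μ₂ β u v = 0 := by
  rw [quarticPart]
  refine integral_eq_zero_of_ae ?_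
  filter_upwards [hu, hv] with x h1 h2
  simp [h1, h2]

/-- The multiple by `t` lies on the Nehari set when `t² Q = t⁴ P`, that is `t² = Q / P`; its energy
is then `t² Q / 4`. -/
lemma exists_smul_mem_nehari (hu : MemWeighted A u) (hv : MemWeighted B v)
    (hQ : 0 < quadraticPart d A B u v) (hP : 0 < quarticPart μ₁ μ₂ β u v) :
    ∃ p ∈ nehari μ₁ μ₂ β d A B, energy μ₁ μ₂ β d A B p.1 p.2
      = quadraticPart d A B u v ^ 2 / (4 * quarticPart μ₁ μ₂ β u v) := by
  set Q := quadraticPart d A B u v with hQd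
  set P := quarticPart μ₁ μ₂ β u v with hPd
  set t := √(Q / P) with ht
  have ht0 : 0 < t := Real.sqrt_pos.2 (div_pos hQ hP)
  have ht2 : t ^ 2 = Q / P := Real.sq_sqrt (div_pos hQ hP).le
  have hQ' : quadraticPart d A B (t • u) (t • v) = t ^ 2 * Q := quadraticPart_smul hu.1 hv.1 t
  have hP' : quarticPart μ₁ μ₂ β (t • u) (t • v) = t ^ 4 * P := quarticPart_smul t
  have hmem : (t • u, t • v) ∈ nehari μ₁ μ₂ β d A B := by
    refine (mem_nehari_iff (hu.const_smul t) (hv.const_smul t)).2 ⟨?_, ?_⟩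
    · rintro ⟨h1, h2⟩
      have h3 := quarticPart_eq_zero (μ₁ := μ₁) (μ₂ := μ₂) (β := β) h1 h2
      rw [hP'] at h3
      have : 0 < t ^ 4 * P := by positivity
      linarith
    · rw [hQ', hP', show t ^ 4 = t ^ 2 * t ^ 2 by ring, ht2]
      field_simp
  refine ⟨_, hmem, ?_⟩
  rw [(energy_of_mem_nehari hmem).2, hQ', ht2]
  field_simp

lemma groundEnergy_le (hd : 0 ≤ d) (hA : ∀ x, 0 ≤ A x) (hB : ∀ x, 0 ≤ B x)
    (hu : MemWeighted A u) (hv : MemWeighted B v)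
    (hQ : 0 < quadraticPart d A B u v) (hP : 0 < quarticPart μ₁ μ₂ β u v) :
    groundEnergy μ₁ μ₂ β d A B
      ≤ quadraticPart d A B u v ^ 2 / (4 * quarticPart μ₁ μ₂ β u v) := by
  obtain ⟨p, hp, he⟩ := exists_smul_mem_nehari hu hv hQ hP
  rw [← he]
  exact csInf_le (bddBelow_energy_nehari hd hA hB) ⟨p, hp, rfl⟩

lemma quadraticPart_eq (hu : MemWeighted A u) (hv : MemWeighted B v) :
    quadraticPart d A B u v = d * (∫ x, ‖weakGradient u x‖ ^ 2) + (∫ x, A x * u x ^ 2)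
      + d * (∫ x, ‖weakGradient v x‖ ^ 2) + ∫ x, B x * v x ^ 2 := by
  have h1 := ((memLp_two_iff_integrable_sq_norm hu.1.weakGradient_spec.1.1).1
    hu.1.weakGradient_spec.1).const_mul d
  have h2 := ((memLp_two_iff_integrable_sq_norm hv.1.weakGradient_spec.1.1).1
    hv.1.weakGradient_spec.1).const_mul d
  have h3 : Integrable (fun x => d * ‖weakGradient u x‖ ^ 2 + A x * u x ^ 2) volume := h1.add hu.2
  have h4 : Integrable (fun x => d * ‖weakGradient u x‖ ^ 2 + A x * u x ^ 2
      + d * ‖weakGradient v x‖ ^ 2) volume := h3.add h2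
  rw [quadraticPart, integral_add h4 hv.2, integral_add h3 h2,
    integral_add h1 hu.2, integral_const_mul, integral_const_mul]

lemma ae_eq_zero_of_integral_eq_zero (hA : ∀ᵐ x, 0 < A x) (hu : MemWeighted A u)
    (h : ∫ x, A x * u x ^ 2 = 0) : u =ᵐ[volume] 0 := by
  have hnn : 0 ≤ᵐ[volume] fun x => A x * u x ^ 2 := by
    filter_upwards [hA] with x hx
    exact mul_nonneg hx.le (sq_nonneg _)
  filter_upwards [hA, (integral_eq_zero_iff_of_nonneg_ae hnn hu.2).1 h] with x h1 h2
  simpa [h1.ne'] using h2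

/-- The potential terms suffice: a potential positive almost everywhere forces the function to
vanish once its weighted integral does. -/
lemma quadraticPart_pos (hd : 0 ≤ d) (hA : ∀ x, 0 ≤ A x) (hB : ∀ x, 0 ≤ B x)
    (hA' : ∀ᵐ x, 0 < A x) (hB' : ∀ᵐ x, 0 < B x) (hu : MemWeighted A u) (hv : MemWeighted B v)
    (h0 : ¬ (u =ᵐ[volume] 0 ∧ v =ᵐ[volume] 0)) : 0 < quadraticPart d A B u v := by
  refine lt_of_le_of_ne (quadraticPart_nonneg hd hA hB) fun h => h0 ?_
  rw [quadraticPart_eq hu hv] at h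
  have n1 : 0 ≤ d * ∫ x, ‖weakGradient u x‖ ^ 2 :=
    mul_nonneg hd (integral_nonneg fun x => by positivity)
  have n2 : 0 ≤ d * ∫ x, ‖weakGradient v x‖ ^ 2 :=
    mul_nonneg hd (integral_nonneg fun x => by positivity)
  have n3 : 0 ≤ ∫ x, A x * u x ^ 2 := integral_nonneg fun x => mul_nonneg (hA x) (sq_nonneg _)
  have n4 : 0 ≤ ∫ x, B x * v x ^ 2 := integral_nonneg fun x => mul_nonneg (hB x) (sq_nonneg _)
  exact ⟨ae_eq_zero_of_integral_eq_zero hA' hu (by linarith),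
    ae_eq_zero_of_integral_eq_zero hB' hv (by linarith)⟩

end Nehari

/-! ### Scaling of the energy at a concentration point. -/

section Rescaling

variable {N : ℕ} {μ₁ μ₂ β d : ℝ} {A B : RSpace N → ℝ} {u v : RSpace N → ℝ}

/-- The potential `A` blown up at `x₀` with length scale `δ`. -/
def blowUp (γ : ℝ) (A : RSpace N → ℝ) (x₀ : RSpace N) (δ : ℝ) (y : RSpace N) : ℝ :=
  A (x₀ + δ • y) / δ ^ γ

lemma quarticPart_rescale (x₀ : RSpace N) {δ : ℝ} (hδ : 0 < δ) :
    quarticPart μ₁ μ₂ β (fun z => u (rescale x₀ δ z)) (fun z => v (rescale x₀ δ z))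
      = δ ^ N * quarticPart μ₁ μ₂ β u v :=
  integral_rescale x₀ hδ fun y => μ₁ * u y ^ 4 + 2 * β * u y ^ 2 * v y ^ 2 + μ₂ * v y ^ 4

/-- The choice `d = δ ^ (γ + 2)` balances the terms: the squared gradient contributes `δ⁻²`, leaving
`δ ^ γ`, the same factor that `blowUp` extracts from the potential. -/
lemma quadraticPart_rescale (hu : MemHOne u) (hv : MemHOne v) (γ : ℝ) (x₀ : RSpace N) {δ : ℝ}
    (hδ : 0 < δ) (hd : d = δ ^ γ * δ ^ 2) :
    quadraticPart d A B (fun z => u (rescale x₀ δ z)) (fun z => v (rescale x₀ δ z))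
      = δ ^ N * (δ ^ γ * quadraticPart 1 (blowUp γ A x₀ δ) (blowUp γ B x₀ δ) u v) := by
  have h := integral_rescale x₀ hδ fun y => δ ^ γ * (1 * ‖weakGradient u y‖ ^ 2
    + blowUp γ A x₀ δ y * u y ^ 2 + 1 * ‖weakGradient v y‖ ^ 2 + blowUp γ B x₀ δ y * v y ^ 2)
  rw [smul_eq_mul] at h
  rw [quadraticPart, quadraticPart, ← integral_const_mul (δ ^ γ), ← h]
  refine integral_congr_ae ?_
  have hγ : 0 < δ ^ γ := Real.rpow_pos_of_pos hδ γ
  filter_upwards [hu.weakGradient_rescale x₀ hδ, hv.weakGradient_rescale x₀ hδ] with z h1 h2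
  simp only [h1, h2, norm_smul, norm_inv, Real.norm_eq_abs, mul_pow, inv_pow, sq_abs, blowUp,
    rescale_add_smul x₀ hδ, hd]
  field_simp

lemma MemWeighted.rescale (γ : ℝ) (x₀ : RSpace N) {δ : ℝ} (hδ : 0 < δ)
    (hu : MemWeighted (blowUp γ A x₀ δ) u) :
    MemWeighted A fun z => u (rescale x₀ δ z) := by
  refine ⟨hu.1.rescale x₀ hδ, ?_⟩
  have hγ : 0 < δ ^ γ := Real.rpow_pos_of_pos hδ γ
  refine (integrable_rescale x₀ hδ (hu.2.const_mul (δ ^ γ))).congr (.of_forall fun z => ?_)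
  simp only [blowUp, rescale_add_smul x₀ hδ]
  field_simp

lemma groundEnergy_le_rescale {γ ε δ : ℝ} (hδ : 0 < δ) (hε : ε ^ 2 = δ ^ γ * δ ^ 2)
    (hA : ∀ x, 0 ≤ A x) (hB : ∀ x, 0 ≤ B x) (x₀ : RSpace N)
    (hu : MemWeighted (blowUp γ A x₀ δ) u) (hv : MemWeighted (blowUp γ B x₀ δ) v)
    (hQ : 0 < quadraticPart 1 (blowUp γ A x₀ δ) (blowUp γ B x₀ δ) u v)
    (hP : 0 < quarticPart μ₁ μ₂ β u v) :
    groundEnergy μ₁ μ₂ β (ε ^ 2) A B / δ ^ (N + 2 * γ : ℝ)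
      ≤ quadraticPart 1 (blowUp γ A x₀ δ) (blowUp γ B x₀ δ) u v ^ 2
        / (4 * quarticPart μ₁ μ₂ β u v) := by
  have hγ : 0 < δ ^ γ := Real.rpow_pos_of_pos hδ γ
  have eQ := quadraticPart_rescale (A := A) (B := B) hu.1 hv.1 γ x₀ hδ hε
  have eP := quarticPart_rescale (μ₁ := μ₁) (μ₂ := μ₂) (β := β) (u := u) (v := v) x₀ hδ
  have h := groundEnergy_le (μ₁ := μ₁) (μ₂ := μ₂) (β := β) (sq_nonneg ε) hA hB
    (hu.rescale γ x₀ hδ) (hv.rescale γ x₀ hδ) (by rw [eQ]; positivity) (by rw [eP]; positivity)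
  rw [eQ, eP] at h
  have hpow : δ ^ (N + 2 * γ : ℝ) = δ ^ N * (δ ^ γ) ^ 2 := by
    rw [Real.rpow_add hδ, Real.rpow_natCast, mul_comm 2 γ, Real.rpow_mul hδ.le]
    norm_num
  rw [hpow, div_le_iff₀ (by positivity)]
  refine h.trans_eq ?_
  field_simp

end Rescaling

/-! ### Approximation by compactly supported pairs. -/

section Cutoff

variable {N : ℕ} {μ₁ μ₂ β : ℝ} {A : RSpace N → ℝ} {u v : RSpace N → ℝ}

/-- A smooth bump function equal to one on the unit ball and supported in the ball of radius two. -/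
def unitBump (N : ℕ) : ContDiffBump (0 : RSpace N) := ⟨1, 2, one_pos, one_lt_two⟩

/-- Smooth cutoff functions exhausting `ℝ^N`. -/
def cutoff {N : ℕ} (n : ℕ) (x : RSpace N) : ℝ := unitBump N (((n : ℝ) + 1)⁻¹ • x)

lemma contDiff_cutoff (n : ℕ) : ContDiff ℝ ∞ (cutoff (N := N) n) :=
  (unitBump N).contDiff.comp (contDiff_id.const_smul _)

lemma hasCompactSupport_cutoff (n : ℕ) : HasCompactSupport (cutoff (N := N) n) :=
  (unitBump N).hasCompactSupport.comp_homeomorph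
    (Homeomorph.smulOfNeZero ((n : ℝ) + 1)⁻¹ (by positivity))

lemma cutoff_nonneg (n : ℕ) (x : RSpace N) : 0 ≤ cutoff n x := (unitBump N).nonneg

lemma cutoff_le_one (n : ℕ) (x : RSpace N) : cutoff n x ≤ 1 := (unitBump N).le_one

lemma cutoff_eq_one {n : ℕ} {x : RSpace N} (h : ‖x‖ ≤ n + 1) : cutoff n x = 1 := by
  refine (unitBump N).one_of_mem_closedBall ?_
  have hn : (0 : ℝ) < n + 1 := by positivity
  rw [mem_closedBall_zero_iff, norm_smul, norm_inv, Real.norm_eq_abs, abs_of_pos hn,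
    inv_mul_le_iff₀ hn]
  simpa [unitBump] using h

lemma tendsto_cutoff (x : RSpace N) : Tendsto (fun n => cutoff n x) atTop (𝓝 1) := by
  refine tendsto_const_nhds.congr' ?_
  obtain ⟨m, hm⟩ := exists_nat_ge ‖x‖
  filter_upwards [eventually_ge_atTop m] with n hn
  have : (m : ℝ) ≤ n := by exact_mod_cast hn
  exact (cutoff_eq_one (by linarith)).symm

lemma exists_gradient_cutoff_bound (N : ℕ) :
    ∃ C, 0 ≤ C ∧ ∀ n (x : RSpace N), ‖gradient (cutoff n) x‖ ≤ C * ((n : ℝ) + 1)⁻¹ := by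
  have hsm : ContDiff ℝ ∞ (unitBump N) := (unitBump N).contDiff
  obtain ⟨C, hC⟩ := ((unitBump N).hasCompactSupport.fderiv (𝕜 := ℝ)).exists_bound_of_continuous
    (hsm.continuous_fderiv (by simp))
  refine ⟨C, (norm_nonneg _).trans (hC 0), fun n x => ?_⟩
  rw [gradient, LinearIsometryEquiv.norm_map]
  have h1 : HasFDerivAt (fun y : RSpace N => ((n : ℝ) + 1)⁻¹ • y)
      (((n : ℝ) + 1)⁻¹ • ContinuousLinearMap.id ℝ (RSpace N)) x :=
    (((n : ℝ) + 1)⁻¹ • ContinuousLinearMap.id ℝ (RSpace N)).hasFDerivAt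
  have h2 := ((hsm.differentiable (by simp) (((n : ℝ) + 1)⁻¹ • x)).hasFDerivAt.comp x h1).fderiv
  rw [show cutoff n = (unitBump N) ∘ fun y : RSpace N => ((n : ℝ) + 1)⁻¹ • y from rfl, h2,
    ContinuousLinearMap.comp_smul, ContinuousLinearMap.comp_id, norm_smul, norm_inv,
    Real.norm_eq_abs, abs_of_pos (by positivity : (0 : ℝ) < n + 1), mul_comm]
  exact mul_le_mul_of_nonneg_right (hC _) (by positivity)

/-- The truncation of `u` by a smooth cutoff. -/
def truncation (n : ℕ) (u : RSpace N → ℝ) (x : RSpace N) : ℝ := cutoff n x * u x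

lemma hasCompactSupport_truncation (n : ℕ) (u : RSpace N → ℝ) :
    HasCompactSupport (truncation n u) :=
  (hasCompactSupport_cutoff n).mul_right

lemma MemHOne.truncation (hu : MemHOne u) (n : ℕ) : MemHOne (truncation n u) ∧
    weakGradient (truncation n u) =ᵐ[volume]
      fun x => cutoff n x • weakGradient u x + u x • gradient (cutoff n) x := by
  obtain ⟨C, -, hC⟩ := exists_gradient_cutoff_bound N
  have hc := (contDiff_cutoff (N := N) n).continuous
  have hg : MemLp (fun x => cutoff n x • weakGradient u x + u x • gradient (cutoff n) x) 2
      volume := by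
    refine MemLp.add ?_ ?_
    · refine hu.weakGradient_spec.1.mono (hc.aestronglyMeasurable.smul hu.weakGradient_spec.1.1)
        (.of_forall fun x => ?_)
      rw [norm_smul, Real.norm_eq_abs, abs_of_nonneg (cutoff_nonneg n x)]
      exact mul_le_of_le_one_left (norm_nonneg _) (cutoff_le_one n x)
    · refine hu.1.of_le_mul (c := C * ((n : ℝ) + 1)⁻¹) (hu.1.1.smul
        (continuous_gradient (contDiff_cutoff n)).aestronglyMeasurable) (.of_forall fun x => ?_)
      rw [norm_smul, mul_comm]
      exact mul_le_mul_of_nonneg_right (hC n x) (norm_nonneg _)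
  have hw := hu.weakGradient_spec.2.smooth_mul (hu.1.locallyIntegrable (by norm_num))
    (hu.weakGradient_spec.1.locallyIntegrable (by norm_num)) (contDiff_cutoff n)
  refine ⟨⟨?_, _, hg, hw⟩, hw.weakGradient_ae_eq hg⟩
  refine hu.1.mono (hc.aestronglyMeasurable.mul hu.1.1) (.of_forall fun x => ?_)
  rw [_root_.truncation, norm_mul, Real.norm_eq_abs, abs_of_nonneg (cutoff_nonneg n x)]
  exact mul_le_of_le_one_left (norm_nonneg _) (cutoff_le_one n x)

lemma integrable_mul_sq_of_hasCompactSupport (hA : Continuous A) (hu : MemLp u 2 volume)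
    (hs : HasCompactSupport u) : Integrable (fun x => A x * u x ^ 2) volume := by
  have h1 := integrableOn_univ.2 hu.integrable_sq
  have h2 : IntegrableOn (fun x => A x * u x ^ 2) (tsupport u) volume :=
    (h1.mono_set (subset_univ _)).continuousOn_mul hA.continuousOn hs.isCompact
  refine (integrableOn_iff_integrable_of_support_subset fun x hx => ?_).1 h2
  refine subset_tsupport u fun h => hx ?_
  simp [h]

lemma MemHOne.memWeighted (hu : MemHOne u) (hs : HasCompactSupport u) (hA : Continuous A) :
    MemWeighted A u :=
  ⟨hu, integrable_mul_sq_of_hasCompactSupport hA hu.1 hs⟩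

lemma tendsto_integral_weakGradient_truncation (hu : MemHOne u) :
    Tendsto (fun n => ∫ x, ‖weakGradient (truncation n u) x‖ ^ 2) atTop
      (𝓝 (∫ x, ‖weakGradient u x‖ ^ 2)) := by
  obtain ⟨C, hC0, hC⟩ := exists_gradient_cutoff_bound N
  have hg2 := (memLp_two_iff_integrable_sq_norm hu.weakGradient_spec.1.1).1 hu.weakGradient_spec.1
  refine tendsto_integral_of_dominated_convergence
    -- The majorant is `2 (p² + q²)` for the two product-rule terms, with the gradient of the cutoff
    -- bounded by `C` uniformly in `n`.
    (fun x => 2 * ‖weakGradient u x‖ ^ 2 + 2 * C ^ 2 * u x ^ 2)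
    (fun n => ((hu.truncation n).1.weakGradient_spec.1.1.norm.pow 2))
    ((hg2.const_mul 2).add (hu.1.integrable_sq.const_mul (2 * C ^ 2))) (fun n => ?_) ?_
  · filter_upwards [(hu.truncation n).2] with x hx
    have hn : ((n : ℝ) + 1)⁻¹ ≤ 1 := inv_le_one_of_one_le₀ (by linarith [n.cast_nonneg (α := ℝ)])
    have h1 : ‖cutoff n x • weakGradient u x‖ ≤ ‖weakGradient u x‖ := by
      rw [norm_smul, Real.norm_eq_abs, abs_of_nonneg (cutoff_nonneg n x)]
      exact mul_le_of_le_one_left (norm_nonneg _) (cutoff_le_one n x)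
    have h2 : ‖u x • gradient (cutoff n) x‖ ≤ |u x| * C := by
      rw [norm_smul, Real.norm_eq_abs]
      exact mul_le_mul_of_nonneg_left ((hC n x).trans (mul_le_of_le_one_right hC0 hn))
        (abs_nonneg _)
    have h3 : ‖weakGradient (truncation n u) x‖ ≤ ‖weakGradient u x‖ + |u x| * C := by
      rw [hx]
      exact (norm_add_le _ _).trans (add_le_add h1 h2)
    rw [Real.norm_eq_abs, abs_of_nonneg (by positivity)]
    calc ‖weakGradient (truncation n u) x‖ ^ 2 ≤ (‖weakGradient u x‖ + |u x| * C) ^ 2 := by gcongr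
      _ ≤ 2 * (‖weakGradient u x‖ ^ 2 + (|u x| * C) ^ 2) := add_sq_le
      _ = _ := by rw [mul_pow, sq_abs]; ring
  · filter_upwards [ae_all_iff.2 fun n => (hu.truncation n).2] with x hx
    simp_rw [hx]
    have h1 : Tendsto (fun n => gradient (cutoff n) x) atTop (𝓝 0) := by
      refine squeeze_zero_norm (fun n => hC n x) ?_
      have := (tendsto_one_div_add_atTop_nhds_zero_nat (𝕜 := ℝ)).const_mul C
      simpa using this
    have h2 := ((tendsto_cutoff x).smul_const (weakGradient u x)).add (h1.const_smul (u x))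
    simpa using h2.norm.pow 2

lemma tendsto_integral_potential_truncation (hA : ∀ x, 0 ≤ A x) (hAc : Continuous A)
    (hu : MemWeighted A u) :
    Tendsto (fun n => ∫ x, A x * truncation n u x ^ 2) atTop (𝓝 (∫ x, A x * u x ^ 2)) := by
  refine tendsto_integral_of_dominated_convergence (fun x => A x * u x ^ 2)
    (fun n => hAc.aestronglyMeasurable.mul ((hu.1.truncation n).1.1.1.pow 2)) hu.2
    (fun n => .of_forall fun x => ?_) (.of_forall fun x => ?_)
  · have h1 : cutoff n x ^ 2 ≤ 1 := pow_le_one₀ (cutoff_nonneg n x) (cutoff_le_one n x)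
    rw [Real.norm_eq_abs, abs_of_nonneg (mul_nonneg (hA x) (sq_nonneg _)), truncation, mul_pow]
    exact mul_le_mul_of_nonneg_left (mul_le_of_le_one_left (sq_nonneg _) h1) (hA x)
  · have h := (((tendsto_cutoff x).mul_const (u x)).pow 2).const_mul (A x)
    simpa [truncation] using h

lemma tendsto_quarticPart_truncation (hμ₁ : 0 ≤ μ₁) (hμ₂ : 0 ≤ μ₂) (hβ : 0 ≤ β)
    (h0 : quarticPart μ₁ μ₂ β u v ≠ 0) :
    Tendsto (fun n => quarticPart μ₁ μ₂ β (truncation n u) (truncation n v)) atTop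
      (𝓝 (quarticPart μ₁ μ₂ β u v)) := by
  -- The Bochner integral of a non-integrable function is `0`, so a nonzero quartic part already
  -- entails integrability.
  have hint : Integrable (fun x => μ₁ * u x ^ 4 + 2 * β * u x ^ 2 * v x ^ 2 + μ₂ * v x ^ 4)
      volume := by
    by_contra h
    exact h0 (integral_undef h)
  have e : ∀ n x, μ₁ * truncation n u x ^ 4 + 2 * β * truncation n u x ^ 2 * truncation n v x ^ 2
      + μ₂ * truncation n v x ^ 4
      = cutoff n x ^ 4 * (μ₁ * u x ^ 4 + 2 * β * u x ^ 2 * v x ^ 2 + μ₂ * v x ^ 4) :=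
    fun n x => by
      simp only [truncation]
      ring
  simp only [quarticPart, e]
  refine tendsto_integral_of_dominated_convergence _
    (fun n => ((contDiff_cutoff n).continuous.pow 4).aestronglyMeasurable.mul hint.1) hint
    (fun n => .of_forall fun x => ?_) (.of_forall fun x => ?_)
  · have h1 : cutoff n x ^ 4 ≤ 1 := pow_le_one₀ (cutoff_nonneg n x) (cutoff_le_one n x)
    have h2 : 0 ≤ μ₁ * u x ^ 4 + 2 * β * u x ^ 2 * v x ^ 2 + μ₂ * v x ^ 4 := by positivity
    have h3 : 0 ≤ cutoff n x ^ 4 := by positivity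
    rw [Real.norm_eq_abs, abs_of_nonneg (mul_nonneg h3 h2)]
    exact mul_le_of_le_one_left h2 h1
  · simpa using ((tendsto_cutoff x).pow 4).mul_const
      (μ₁ * u x ^ 4 + 2 * β * u x ^ 2 * v x ^ 2 + μ₂ * v x ^ 4)

lemma tendsto_quadraticPart_truncation (hA : ∀ x, 0 ≤ A x) (hAc : Continuous A)
    (hu : MemWeighted A u) (hv : MemWeighted A v) :
    Tendsto (fun n => quadraticPart 1 A A (truncation n u) (truncation n v)) atTop
      (𝓝 (quadraticPart 1 A A u v)) := by
  have hm : ∀ n {w : RSpace N → ℝ}, MemWeighted A w → MemWeighted A (truncation n w) :=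
    fun n w hw => (hw.1.truncation n).1.memWeighted (hasCompactSupport_truncation n w) hAc
  have e : ∀ n, quadraticPart 1 A A (truncation n u) (truncation n v) = _ :=
    fun n => quadraticPart_eq (hm n hu) (hm n hv)
  simp_rw [e]
  rw [quadraticPart_eq hu hv]
  exact ((((tendsto_integral_weakGradient_truncation hu.1).const_mul 1).add
    (tendsto_integral_potential_truncation hA hAc hu)).add
    ((tendsto_integral_weakGradient_truncation hv.1).const_mul 1)).add
    (tendsto_integral_potential_truncation hA hAc hv)

end Cutoff

/-! ### Convergence of the blown-up potentials and the upper bound. -/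

section BlowUp

variable {N : ℕ} {μ₁ μ₂ β γ : ℝ} {a b W : RSpace N → ℝ} {x₀ : RSpace N} {u v : RSpace N → ℝ}

lemma IsPosHomogeneous.map_zero (hγ : 0 < γ) (hW : IsPosHomogeneous γ W) : W 0 = 0 := by
  have := hW.2 0 le_rfl 0
  simpa [Real.zero_rpow hγ.ne'] using this

lemma IsPosHomogeneous.nonneg (hγ : 0 < γ) (hW : IsPosHomogeneous γ W) (y : RSpace N) :
    0 ≤ W y := by
  rcases eq_or_ne y 0 with rfl | hy
  · exact (hW.map_zero hγ).ge
  · exact (hW.1 y hy).le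

lemma IsPosHomogeneous.ae_pos (hN : 1 ≤ N) (hW : IsPosHomogeneous γ W) : ∀ᵐ y, 0 < W y := by
  have : Nonempty (Fin N) := ⟨⟨0, hN⟩⟩
  have h : ∀ᵐ y : RSpace N, y ≠ 0 := compl_mem_ae_iff.2 (measure_singleton 0)
  filter_upwards [h] with y hy
  exact hW.1 y hy

lemma continuous_blowUp (ha : Continuous a) (δ : ℝ) : Continuous (blowUp γ a x₀ δ) :=
  (ha.comp (continuous_const.add (continuous_const_smul δ))).div_const _

/-- Put `z = x₀ + δ • y` in the local model: homogeneity turns `W (δ • y)` into `δ ^ γ * W y`, and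
`δ ^ γ` cancels. The origin is treated apart, because the model concerns a punctured neighbourhood.
-/
lemma HasLocalModel.blowUp_sub_le (h : HasLocalModel γ a x₀ W) (hγ : 0 < γ)
    (hW : IsPosHomogeneous γ W) (ha0 : a x₀ = 0) {η : ℝ} (hη : 0 < η) (R : ℝ) :
    ∀ᶠ δ in 𝓝[>] (0 : ℝ), ∀ y, ‖y‖ ≤ R → |blowUp γ a x₀ δ y - W y| ≤ η * ‖y‖ ^ γ := by
  have h1 := Metric.tendsto_nhdsWithin_nhds.1 h η hη
  obtain ⟨r, hr, h1⟩ := h1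
  have hR : 0 < |R| + 1 := by positivity
  filter_upwards [Ioo_mem_nhdsGT (div_pos hr hR)] with δ hδ y hy
  have hδ0 : 0 < δ := hδ.1
  have hδγ : 0 < δ ^ γ := Real.rpow_pos_of_pos hδ0 γ
  rcases eq_or_ne y 0 with rfl | hy0
  · simp [blowUp, ha0, hW.map_zero hγ, Real.zero_rpow hγ.ne']
  have hyn : 0 < ‖y‖ := norm_pos_iff.2 hy0
  have hz : x₀ + δ • y ≠ x₀ := by simpa using ⟨hδ0.ne', hy0⟩
  have hnorm : ‖x₀ + δ • y - x₀‖ = δ * ‖y‖ := by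
    rw [add_sub_cancel_left, norm_smul, Real.norm_eq_abs, abs_of_pos hδ0]
  have hd : dist (x₀ + δ • y) x₀ < r := by
    rw [dist_eq_norm, hnorm]
    calc δ * ‖y‖ ≤ δ * (|R| + 1) := by
          gcongr
          linarith [le_abs_self R]
      _ < r := (lt_div_iff₀ hR).1 hδ.2
  have h2 := (h1 hz hd).le
  rw [dist_zero_right, hnorm, add_sub_cancel_left, hW.2 δ hδ0.le, Real.norm_eq_abs, abs_div,
    Real.mul_rpow hδ0.le hyn.le, abs_of_pos (mul_pos hδγ (Real.rpow_pos_of_pos hyn γ)),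
    div_le_iff₀ (mul_pos hδγ (Real.rpow_pos_of_pos hyn γ))] at h2
  have e : blowUp γ a x₀ δ y - W y = (a (x₀ + δ • y) - δ ^ γ * W y) / δ ^ γ := by
    rw [blowUp]
    field_simp
  rw [e, abs_div, abs_of_pos hδγ, div_le_iff₀ hδγ]
  linarith

lemma HasLocalModel.tendsto_blowUp (h : HasLocalModel γ a x₀ W) (hγ : 0 < γ)
    (hW : IsPosHomogeneous γ W) (ha0 : a x₀ = 0) (y : RSpace N) :
    Tendsto (fun δ => blowUp γ a x₀ δ y) (𝓝[>] 0) (𝓝 (W y)) := by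
  refine Metric.tendsto_nhds.2 fun e he => ?_
  have hy : 0 < ‖y‖ ^ γ + 1 := by positivity
  filter_upwards [h.blowUp_sub_le hγ hW ha0 (div_pos he hy) ‖y‖] with δ hδ
  rw [Real.dist_eq]
  refine (hδ y le_rfl).trans_lt ?_
  rw [div_mul_eq_mul_div, div_lt_iff₀ hy]
  nlinarith

lemma HasLocalModel.tendsto_integral_blowUp (h : HasLocalModel γ a x₀ W) (hγ : 0 < γ)
    (ha : Continuous a) (hWc : Continuous W) (hW : IsPosHomogeneous γ W) (ha0 : a x₀ = 0)
    (hu : MemLp u 2 volume) (hs : HasCompactSupport u) :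
    Tendsto (fun δ => ∫ y, blowUp γ a x₀ δ y * u y ^ 2) (𝓝[>] 0) (𝓝 (∫ y, W y * u y ^ 2)) := by
  obtain ⟨R, hR⟩ := hs.isCompact.isBounded.subset_closedBall 0
  refine tendsto_integral_filter_of_dominated_convergence
    (fun y => (W y + ‖y‖ ^ γ) * u y ^ 2)
    (.of_forall fun δ => (continuous_blowUp ha δ).aestronglyMeasurable.mul (hu.1.pow 2)) ?_
    (integrable_mul_sq_of_hasCompactSupport
      (hWc.add (continuous_norm.rpow_const fun _ => .inr hγ.le)) hu hs)
    (.of_forall fun y => (h.tendsto_blowUp hγ hW ha0 y).mul_const _)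
  -- With tolerance `1` on a ball containing the support, the blown-up potential is bounded by `W y
  -- + ‖y‖ ^ γ`, which is the majorant.
  filter_upwards [h.blowUp_sub_le hγ hW ha0 one_pos R] with δ hδ
  refine .of_forall fun y => ?_
  by_cases hy : y ∈ tsupport u
  · have h1 := hδ y (by simpa using hR hy)
    have h2 := hW.nonneg hγ y
    rw [norm_mul, Real.norm_eq_abs, Real.norm_eq_abs, abs_of_nonneg (sq_nonneg (u y))]
    refine mul_le_mul_of_nonneg_right ?_ (sq_nonneg _)
    rw [abs_le] at h1 ⊢
    constructor <;> linarith
  · simp [image_eq_zero_of_notMem_tsupport hy]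

lemma tendsto_quadraticPart_blowUp (hma : HasLocalModel γ a x₀ W) (hmb : HasLocalModel γ b x₀ W)
    (hγ : 0 < γ) (ha : Continuous a) (hb : Continuous b) (hWc : Continuous W)
    (hW : IsPosHomogeneous γ W) (ha0 : a x₀ = 0) (hb0 : b x₀ = 0)
    (hu : MemHOne u) (hv : MemHOne v) (hsu : HasCompactSupport u) (hsv : HasCompactSupport v) :
    Tendsto (fun δ => quadraticPart 1 (blowUp γ a x₀ δ) (blowUp γ b x₀ δ) u v) (𝓝[>] 0)
      (𝓝 (quadraticPart 1 W W u v)) := by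
  have e : ∀ δ, quadraticPart 1 (blowUp γ a x₀ δ) (blowUp γ b x₀ δ) u v = _ := fun δ =>
    quadraticPart_eq (hu.memWeighted hsu (continuous_blowUp ha δ))
      (hv.memWeighted hsv (continuous_blowUp hb δ))
  simp_rw [e]
  rw [quadraticPart_eq (hu.memWeighted hsu hWc) (hv.memWeighted hsv hWc)]
  exact ((tendsto_const_nhds.add
    (hma.tendsto_integral_blowUp hγ ha hWc hW ha0 hu.1 hsu)).add tendsto_const_nhds).add
    (hmb.tendsto_integral_blowUp hγ hb hWc hW hb0 hv.1 hsv)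

lemma tendsto_rpow_nhdsGT_zero {k : ℝ} (hk : 0 < k) :
    Tendsto (fun ε : ℝ => ε ^ k) (𝓝[>] 0) (𝓝[>] 0) := by
  refine tendsto_nhdsWithin_iff.2 ⟨?_, ?_⟩
  · have h := (Real.continuous_rpow_const hk.le).tendsto (0 : ℝ)
    rw [Real.zero_rpow hk.ne'] at h
    exact h.mono_left nhdsWithin_le_nhds
  · filter_upwards [self_mem_nhdsWithin] with ε hε
    exact Real.rpow_pos_of_pos hε k

lemma limsup_semiclassicalLevel_le_of_hasCompactSupport
    (hma : HasLocalModel γ a x₀ W) (hmb : HasLocalModel γ b x₀ W)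
    (hγ : 0 < γ) (ha : Continuous a) (hb : Continuous b) (han : ∀ x, 0 ≤ a x) (hbn : ∀ x, 0 ≤ b x)
    (hWc : Continuous W) (hW : IsPosHomogeneous γ W) (ha0 : a x₀ = 0) (hb0 : b x₀ = 0)
    (hu : MemHOne u) (hv : MemHOne v) (hsu : HasCompactSupport u) (hsv : HasCompactSupport v)
    (hQ : 0 < quadraticPart 1 W W u v) (hP : 0 < quarticPart μ₁ μ₂ β u v) :
    limsup (fun ε : ℝ =>
        ((semiclassicalLevel μ₁ μ₂ β a b ε / ε ^ (2 / (2 + γ) * (N + 2 * γ)) : ℝ) : EReal))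
      (𝓝[>] 0) ≤
      ((quadraticPart 1 W W u v ^ 2 / (4 * quarticPart μ₁ μ₂ β u v) : ℝ) : EReal) := by
  set k : ℝ := 2 / (2 + γ) with hk
  have hk0 : 0 < k := by positivity
  have hT := (tendsto_quadraticPart_blowUp hma hmb hγ ha hb hWc hW ha0 hb0 hu hv hsu hsv).comp
    (tendsto_rpow_nhdsGT_zero hk0)
  have hlim := (continuous_coe_real_ereal.tendsto _).comp
    ((hT.pow 2).div_const (4 * quarticPart μ₁ μ₂ β u v))
  rw [← hlim.limsup_eq]
  refine limsup_le_limsup ?_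
  filter_upwards [self_mem_nhdsWithin, hT.eventually (lt_mem_nhds hQ)] with ε hε hQε
  have hε0 : (0 : ℝ) < ε := hε
  have hδ : 0 < ε ^ k := Real.rpow_pos_of_pos hε0 k
  -- This is `k (γ + 2) = 2`, the relation that fixes `k`.
  have hscale : ε ^ 2 = (ε ^ k) ^ γ * (ε ^ k) ^ 2 := by
    rw [← Real.rpow_natCast (ε ^ k) 2, ← Real.rpow_add hδ, ← Real.rpow_mul hε0.le,
      ← Real.rpow_natCast ε 2]
    congr 1
    rw [hk]
    push_cast
    field_simp
    ring
  rw [Real.rpow_mul hε0.le]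
  exact EReal.coe_le_coe_iff.2 (groundEnergy_le_rescale hδ hscale han hbn x₀
    (hu.memWeighted hsu (continuous_blowUp ha _)) (hv.memWeighted hsv (continuous_blowUp hb _))
    hQε hP)

/-- Truncate the pair, apply the compactly supported bound for large `n`, and let `n → ∞`. Since `P
= Q` for the pair itself, the limit `Q² / (4P)` is its energy. -/
lemma limsup_semiclassicalLevel_le_energy (hN : 1 ≤ N)
    (hμ₁ : 0 ≤ μ₁) (hμ₂ : 0 ≤ μ₂) (hβ : 0 ≤ β)
    (hma : HasLocalModel γ a x₀ W) (hmb : HasLocalModel γ b x₀ W)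
    (hγ : 0 < γ) (ha : Continuous a) (hb : Continuous b) (han : ∀ x, 0 ≤ a x) (hbn : ∀ x, 0 ≤ b x)
    (hWc : Continuous W) (hW : IsPosHomogeneous γ W) (ha0 : a x₀ = 0) (hb0 : b x₀ = 0)
    {p : (RSpace N → ℝ) × (RSpace N → ℝ)} (hp : p ∈ nehari μ₁ μ₂ β 1 W W) :
    limsup (fun ε : ℝ =>
        ((semiclassicalLevel μ₁ μ₂ β a b ε / ε ^ (2 / (2 + γ) * (N + 2 * γ)) : ℝ) : EReal))
      (𝓝[>] 0) ≤ ((energy μ₁ μ₂ β 1 W W p.1 p.2 : ℝ) : EReal) := by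
  obtain ⟨hPQ, hE⟩ := energy_of_mem_nehari hp
  have hWn := hW.nonneg hγ
  have hQ := quadraticPart_pos zero_le_one hWn hWn (hW.ae_pos hN) (hW.ae_pos hN) hp.1 hp.2.1
    hp.2.2.1
  have hP : 0 < quarticPart μ₁ μ₂ β p.1 p.2 := hPQ ▸ hQ
  have tQ := tendsto_quadraticPart_truncation hWn hWc hp.1 hp.2.1
  have tP := tendsto_quarticPart_truncation hμ₁ hμ₂ hβ hP.ne'
  have hlim := (continuous_coe_real_ereal.tendsto _).comp
    ((tQ.pow 2).div (tP.const_mul 4) (by positivity))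
  have hval : quadraticPart 1 W W p.1 p.2 ^ 2 / (4 * quarticPart μ₁ μ₂ β p.1 p.2)
      = energy μ₁ μ₂ β 1 W W p.1 p.2 := by
    rw [hE, hPQ]
    field_simp
  rw [← hval]
  refine ge_of_tendsto hlim ?_
  filter_upwards [tQ.eventually (lt_mem_nhds hQ), tP.eventually (lt_mem_nhds hP)] with n hn1 hn2
  exact limsup_semiclassicalLevel_le_of_hasCompactSupport hma hmb hγ ha hb han hbn hWc hW ha0 hb0
    (hp.1.1.truncation n).1 (hp.2.1.1.truncation n).1 (hasCompactSupport_truncation n _)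
    (hasCompactSupport_truncation n _) hn1 hn2

/-- Needed because the real `sInf` of the empty set is `0`, so a bound by every energy would not
pass to `groundEnergy`. A pair of equal bumps, suitably scaled, is a witness. -/
lemma nehari_nonempty (hN : 1 ≤ N) (hμ₁ : 0 < μ₁) (hμ₂ : 0 < μ₂) (hβ : 0 < β)
    (hγ : 0 < γ) (hWc : Continuous W) (hW : IsPosHomogeneous γ W) :
    (nehari μ₁ μ₂ β 1 W W).Nonempty := by
  have hc : Continuous (cutoff (N := N) 0) := (contDiff_cutoff 0).continuous
  have hone : cutoff 0 (0 : RSpace N) = 1 := cutoff_eq_one (by simp)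
  have hm : MemWeighted W (cutoff (N := N) 0) :=
    (memHOne_of_contDiff (contDiff_cutoff 0) (hasCompactSupport_cutoff 0)).memWeighted
      (hasCompactSupport_cutoff 0) hWc
  have hP : 0 < quarticPart μ₁ μ₂ β (cutoff (N := N) 0) (cutoff 0) := by
    refine Continuous.integral_pos_of_hasCompactSupport_nonneg_nonzero (x := 0) (by fun_prop) ?_
      (fun x => by simp only [Pi.zero_apply]; positivity) ?_
    · exact (hasCompactSupport_cutoff 0).comp_left
        (g := fun s : ℝ => μ₁ * s ^ 4 + 2 * β * s ^ 2 * s ^ 2 + μ₂ * s ^ 4) (by simp)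
    · simp only [hone]
      positivity
  have hQ : 0 < quadraticPart 1 W W (cutoff (N := N) 0) (cutoff 0) := by
    refine quadraticPart_pos zero_le_one (hW.nonneg hγ) (hW.nonneg hγ) (hW.ae_pos hN)
      (hW.ae_pos hN) hm hm fun h => ?_
    rw [quarticPart_eq_zero h.1 h.2] at hP
    exact hP.false
  obtain ⟨p, hp, -⟩ := exists_smul_mem_nehari hm hm hQ hP
  exact ⟨p, hp⟩

lemma EReal.le_coe_sInf {S : Set ℝ} (hS : S.Nonempty) (hb : BddBelow S) {l : EReal}
    (h : ∀ E ∈ S, l ≤ (E : EReal)) : l ≤ (sInf S : ℝ) := by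
  obtain ⟨s, -, hs, hmem⟩ := exists_seq_tendsto_sInf hS hb
  have hlim : Tendsto (fun n => (s n : EReal)) atTop (𝓝 ((sInf S : ℝ) : EReal)) :=
    (continuous_coe_real_ereal.tendsto _).comp hs
  exact ge_of_tendsto' hlim fun n => h _ (hmem n)

lemma limsup_semiclassicalLevel_le_limitLevel (hN : 1 ≤ N)
    (hμ₁ : 0 < μ₁) (hμ₂ : 0 < μ₂) (hβ : 0 < β)
    (hma : HasLocalModel γ a x₀ W) (hmb : HasLocalModel γ b x₀ W)
    (hγ : 0 < γ) (ha : Continuous a) (hb : Continuous b) (han : ∀ x, 0 ≤ a x) (hbn : ∀ x, 0 ≤ b x)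
    (hWc : Continuous W) (hW : IsPosHomogeneous γ W) (ha0 : a x₀ = 0) (hb0 : b x₀ = 0) :
    limsup (fun ε : ℝ =>
        ((semiclassicalLevel μ₁ μ₂ β a b ε / ε ^ (2 / (2 + γ) * (N + 2 * γ)) : ℝ) : EReal))
      (𝓝[>] 0) ≤ (limitLevel μ₁ μ₂ β W : EReal) := by
  have hWn := hW.nonneg hγ
  have hne := nehari_nonempty hN hμ₁ hμ₂ hβ hγ hWc hW
  have hbdd := bddBelow_energy_nehari (μ₁ := μ₁) (μ₂ := μ₂) (β := β) zero_le_one hWn hWn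
  rw [limitLevel, groundEnergy]
  have h : ∀ E ∈ (fun p => energy μ₁ μ₂ β 1 W W p.1 p.2) '' nehari μ₁ μ₂ β 1 W W,
      limsup (fun ε : ℝ =>
        ((semiclassicalLevel μ₁ μ₂ β a b ε / ε ^ (2 / (2 + γ) * (N + 2 * γ)) : ℝ) : EReal))
      (𝓝[>] 0) ≤ (E : EReal) := by
    intro E hE
    obtain ⟨p, hp, rfl⟩ := hE
    exact limsup_semiclassicalLevel_le_energy hN hμ₁.le hμ₂.le hβ.le hma hmb hγ ha hb han hbn hWc
      hW ha0 hb0 hp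
  exact EReal.le_coe_sInf (hne.image _) hbdd h

end BlowUp

/-! ### Finiteness of the set of common zeros. -/

section CommonZeros

variable {N : ℕ} {γ : ℝ} {a b W : RSpace N → ℝ} {x : RSpace N}

lemma IsCriticalPotential.nonneg (ha : IsCriticalPotential a) (x : RSpace N) : 0 ≤ a x :=
  ha.2.1.1 (mem_range_self x)

lemma IsCriticalPotential.isBounded_zeros (ha : IsCriticalPotential a) :
    Bornology.IsBounded {x | a x = 0} := by
  have h : ∀ᶠ x in Bornology.cobounded (RSpace N), (0 : EReal) < a x :=
    eventually_lt_of_lt_liminf ha.2.2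
  refine Bornology.isBounded_def.2 (mem_of_superset h fun x hx h0 => ?_)
  have h0' : a x = 0 := h0
  simp [h0'] at hx

lemma IsSteepAt.eventually_ne_zero (h : IsSteepAt γ a x) : ∀ᶠ z in 𝓝[≠] x, a z ≠ 0 := by
  filter_upwards [h.eventually_gt_atTop 0] with z hz h0
  simp [h0] at hz

/-- On the unit sphere `W` has a positive lower bound `m`. At a zero `z` of `a` the model quotient
is minus the value of `W` in the direction of `z - x`, of size at least `m`, which is impossible
close to `x`. -/
lemma HasLocalModel.eventually_ne_zero (h : HasLocalModel γ a x W) (hWc : Continuous W)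
    (hW : IsPosHomogeneous γ W) : ∀ᶠ z in 𝓝[≠] x, a z ≠ 0 := by
  obtain ⟨m, hm, hmW⟩ := (isCompact_sphere (0 : RSpace N) 1).exists_forall_le' hWc.continuousOn
    (a := 0) fun y hy => hW.1 y (ne_zero_of_mem_unit_sphere ⟨y, hy⟩)
  filter_upwards [h.eventually (Metric.ball_mem_nhds 0 hm), self_mem_nhdsWithin] with z hz hzx h0
  have hn : 0 < ‖z - x‖ := norm_pos_iff.2 (sub_ne_zero.2 hzx)
  have hnγ : 0 < ‖z - x‖ ^ γ := Real.rpow_pos_of_pos hn γ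
  have h1 := hmW (‖z - x‖⁻¹ • (z - x)) (by simp [norm_smul, hn.ne'])
  have h2 := hW.2 ‖z - x‖ hn.le (‖z - x‖⁻¹ • (z - x))
  rw [smul_inv_smul₀ hn.ne'] at h2
  rw [dist_zero_right, h0, h2, zero_sub, neg_div, norm_neg, mul_div_cancel_left₀ _ hnγ.ne',
    Real.norm_eq_abs] at hz
  linarith [le_abs_self (W (‖z - x‖⁻¹ • (z - x)))]

/-- The positive lower limit at infinity bounds the zeros, so an infinite set of them would
accumulate at a common zero, near which `a` does not vanish elsewhere. -/
lemma finite_commonZeros (ha : IsCriticalPotential a) (hb : IsCriticalPotential b)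
    (hcases : ∀ x ∈ commonZeros a b, IsSteepAt γ a x ∨
      ∃ W : RSpace N → ℝ, Continuous W ∧ IsPosHomogeneous γ W ∧ HasLocalModel γ a x W) :
    (commonZeros a b).Finite := by
  have hcl : IsClosed (commonZeros a b) :=
    (isClosed_eq ha.1 continuous_const).inter (isClosed_eq hb.1 continuous_const)
  have hK : IsCompact (commonZeros a b) :=
    Metric.isCompact_of_isClosed_isBounded hcl (ha.isBounded_zeros.subset fun x hx => hx.1)
  by_contra hinf
  obtain ⟨x, hx, hacc⟩ := Set.Infinite.exists_accPt_of_subset_isCompact hinf hK subset_rfl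
  have hev : ∀ᶠ z in 𝓝[≠] x, a z ≠ 0 := by
    rcases hcases x hx with h | ⟨W, hWc, hW, h⟩
    · exact h.eventually_ne_zero
    · exact h.eventually_ne_zero hWc hW
  obtain ⟨z, hz, hne⟩ := ((accPt_iff_frequently_nhdsNE.1 hacc).and_eventually hev).exists
  exact hne hz.1

end CommonZeros

end

theorem proposition4p3 (N : ℕ) (hN1 : 1 ≤ N) (hN3 : N ≤ 3)
    (μ₁ μ₂ β : ℝ) (hμ₁ : 0 < μ₁) (hμ₂ : 0 < μ₂) (hβ : 0 < β)
    (a b : RSpace N → ℝ) (ha : IsCriticalPotential a) (hb : IsCriticalPotential b)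
    (γ : ℝ) (hγ : 0 < γ)
    (hcases : ∀ x ∈ commonZeros a b, IsSteepAt γ a x ∨
      ∃ W : RSpace N → ℝ, Continuous W ∧ IsPosHomogeneous γ W ∧ HasLocalModel γ a x W)
    (hne : (modelPoints γ a b).Nonempty)
    (W : RSpace N → RSpace N → ℝ)
    (hW : ∀ x ∈ modelPoints γ a b, Continuous (W x) ∧ IsPosHomogeneous γ (W x) ∧
      HasLocalModel γ a x (W x) ∧ HasLocalModel γ b x (W x)) :
    ∃ xs ∈ modelPoints γ a b,
      limsup (fun ε : ℝ =>
          ((semiclassicalLevel μ₁ μ₂ β a b ε / ε ^ (2 / (2 + γ) * (N + 2 * γ)) : ℝ) : EReal))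
        (𝓝[>] 0) ≤ (limitLevel μ₁ μ₂ β (W xs) : EReal) ∧
      (limitLevel μ₁ μ₂ β (W xs) : EReal) =
        ⨅ x ∈ modelPoints γ a b, (limitLevel μ₁ μ₂ β (W x) : EReal) := by
  have hfin : (modelPoints γ a b).Finite := (finite_commonZeros ha hb hcases).subset fun x hx => hx.1
  obtain ⟨xs, hxs, hmin⟩ := Set.exists_min_image _ (fun x => limitLevel μ₁ μ₂ β (W x)) hfin hne
  obtain ⟨hWc, hWh, hma, hmb⟩ := hW xs hxs
  refine ⟨xs, hxs, ?_, ?_⟩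
  · exact limsup_semiclassicalLevel_le_limitLevel hN1 hμ₁ hμ₂ hβ hma hmb hγ ha.1 hb.1 ha.nonneg
      hb.nonneg hWc hWh hxs.1.1 hxs.1.2
  · exact le_antisymm (le_iInf₂ fun x hx => EReal.coe_le_coe_iff.2 (hmin x hx))
      (iInf₂_le xs hxs)
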